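/- Let $\mathcal C$ be a category with finite limits in which every object $X$ has a parametrised list object, that is, an object $L(X)$ with arrows $\varnothing:\mathbb 1\to L(X)$ and $(x,\ell)\mapsto x::\ell$, $X\times L(X)\to L(X)$, such that for all $g:A\to B$ and $h:X\times B\to B$ there is a unique $f:A\times L(X)\to B$ with $f(a,\varnothing)=g(a)$ and $f(a,x::\ell)=h(x,f(a,\ell))$. (Equations between terms in variables denote equations between the corresponding arrows of $\mathcal C$; the same applies below to equalisers.) Let $N=L(\mathbb 1)$ be the resulting natural numbers object, with zero $0:\mathbb 1\to N$ and successor $s:N\to N$. Define by recursion the predecessor $P:N\to N$ ($P(0)=0$, $P(s\,n)=n$), truncated subtraction $m\mathbin{\dot-}n$ on $N$ ($m\mathbin{\dot-}0=m$, $m\mathbin{\dot-}s\,n=P(m\mathbin{\dot-}n)$) and, for each $X$, the arrows - $\operatorname{len}_X:L(X)\to N$, with $\operatorname{len}_X(\varnothing)=0$ and $\operatorname{len}_X(x::\ell)=s(\operatorname{len}_X(\ell))$; - $\operatorname{tr}_X:L(X)\to L(X)$, with $\operatorname{tr}_X(\varnothing)=\varnothing$ and $\operatorname{tr}_X(x::\ell)=\ell$;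 - $\operatorname{tail}_X:N\times L(X)\to L(X)$, with $\operatorname{tail}_X(0,\ell)=\ell$ and $\operatorname{tail}_X(s\,n,\ell)=\operatorname{tr}_X(\operatorname{tail}_X(n,\ell))$; - $\operatorname{zerothDef}_X:X\times L(X)\to X$, with $\operatorname{zerothDef}_X(x,\varnothing)=x$ and $\operatorname{zerothDef}_X(x,y::\ell)=y$; - $\operatorname{nthDef}_X:X\times N\times L(X)\to X$, $\operatorname{nthDef}_X(x,n,\ell)=\operatorname{zerothDef}_X(x,\operatorname{tail}_X(n,\ell))$. Write $m<n$ for $s(m)\mathbin{\dot-}n=0$, let $E=\{m:N,\ n:N\mid m<n\}$ (an equaliser), and let $\pi_2^E:E\to N$ be $(m,n)\mapsto n$. For $l_A:A\to N$ let $E\times_N A$ be the pullback of $\pi_2^E$ along $l_A$; it is the object of pairs $(m,a)$ with $m<l_A(a)$. For $h:A\to L(X)$ with $\operatorname{len}_X\circ h=l_A$, let $\operatorname{Id}_E\times_N h:E\times_N A\to E\times_N L(X)$ be the induced arrow, where $E\times_N L(X)$ is formed along $\operatorname{len}_X$. Assume the following two hypotheses. - **(H1)** For every object $X$, both squares of the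 following commutative diagram are pullbacks: $$\begin{array}{ccccc}\mathbb 1&\xrightarrow{\ \varnothing\ }&L(X)&\xleftarrow{\ ::\ }&X\times L(X)\\ \downarrow&&\downarrow{\scriptstyle\operatorname{len}_X}&&\downarrow{\scriptstyle\operatorname{len}_X\circ\pi_2}\\ \mathbb 1&\xrightarrow{\ 0\ }&N&\xleftarrow{\ s\ }&N\end{array}$$ - **(H2)** The coproduct $\mathbb 1\xrightarrow{0}N\xleftarrow{s}N$ is universal, that is, its pullback along any arrow into $N$ is again a coproduct. On $E\times_N L(X)$, whose elements are the pairs $(m,\ell)$ with $m<\operatorname{len}_X(\ell)$, one has $\operatorname{len}_X(\ell)=s(P(\operatorname{len}_X(\ell)))$, so by (H1) $\ell=x::\ell'$ for a unique pair $(x,\ell')$ of terms in this context. Put $\operatorname{def}_X=x$ and define $\operatorname{nth}_X:E\times_N L(X)\to X$ by $\operatorname{nth}_X(m,\ell)=\operatorname{nthDef}_X(\operatorname{def}_X,m,\ell)$. Then, for all objects $A,X$ and all arrows $h_1,h_2:A\to L(X)$: if $\operatorname{len}_X\circ h_1=\operatorname{len}_X\circ h_2$ and $\operatorname{nth}_X\circ(\operatorname{Id}_E\times_N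 h_1)=\operatorname{nth}_X\circ(\operatorname{Id}_E\times_N h_2)$ (both arrows having domain the pullback $E\times_N A$ along the common arrow $\operatorname{len}_X\circ h_1=\operatorname{len}_X\circ h_2$), then $h_1=h_2$. -/

import Mathlib

open CategoryTheory CategoryTheory.Limits CategoryTheory.MonoidalCategory
open CategoryTheory.CartesianMonoidalCategory

universe v u

namespace ListPoly

/-- A (parametrised) list object on `X` in a category with finite products (`A ⊗ B` is the
product of `A` and `B`, and `𝟙_ C` is the terminal object): an object `obj` with arrows
`nil : 1 ⟶ obj` and `cons : X × obj ⟶ obj` such that, for all `g : A ⟶ B` and `h : X × B ⟶ B`,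
there is a unique `f : A × obj ⟶ B` with `f (a, nil) = g a` and
`f (a, cons (x, l)) = h (x, f (a, l))`. -/
structure ListObject {C : Type u} [Category.{v} C] [CartesianMonoidalCategory C] (X : C) where
  obj : C
  nil : 𝟙_ C ⟶ obj
  cons : X ⊗ obj ⟶ obj
  existsUnique_fold : ∀ {A B : C} (g : A ⟶ B) (h : X ⊗ B ⟶ B),
    ∃! f : A ⊗ obj ⟶ B,
      lift (𝟙 A) (toUnit A ≫ nil) ≫ f = g ∧
      (A ◁ cons) ≫ f = lift (snd A (X ⊗ obj) ≫ fst X obj) ((A ◁ snd X obj) ≫ f) ≫ h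

noncomputable section

variable {C : Type u} [Category.{v} C] [CartesianMonoidalCategory C]

attribute [local simp] comp_lift_assoc

/-! ### Recursion on a list object -/

/-- Recursion in which the step may also use the parameter and the tail of the list:
`f (a, nil) = g a` and `f (a, cons (x, l)) = h (a, x, l, f (a, l))`. -/
theorem ListObject.existsUnique_primRec {X : C} (L : ListObject X) {A B : C} (g : A ⟶ B)
    (h : A ⊗ (X ⊗ (L.obj ⊗ B)) ⟶ B) :
    ∃! f : A ⊗ L.obj ⟶ B,
      lift (𝟙 A) (toUnit A ≫ L.nil) ≫ f = g ∧
      (A ◁ L.cons) ≫ f =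
        lift (fst A (X ⊗ L.obj)) (lift (snd A (X ⊗ L.obj) ≫ fst X L.obj)
          (lift (snd A (X ⊗ L.obj) ≫ snd X L.obj) ((A ◁ snd X L.obj) ≫ f))) ≫ h := by
  let G : A ⟶ A ⊗ (L.obj ⊗ B) := lift (𝟙 A) (lift (toUnit A ≫ L.nil) g)
  let pA : X ⊗ (A ⊗ (L.obj ⊗ B)) ⟶ A := snd _ _ ≫ fst _ _
  let pL : X ⊗ (A ⊗ (L.obj ⊗ B)) ⟶ L.obj := snd _ _ ≫ snd _ _ ≫ fst _ _
  let pB : X ⊗ (A ⊗ (L.obj ⊗ B)) ⟶ B := snd _ _ ≫ snd _ _ ≫ snd _ _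
  let H : X ⊗ (A ⊗ (L.obj ⊗ B)) ⟶ A ⊗ (L.obj ⊗ B) :=
    lift pA (lift (lift (fst _ _) pL ≫ L.cons) (lift pA (lift (fst _ _) (lift pL pB)) ≫ h))
  obtain ⟨F, ⟨F0, F1⟩, Fu⟩ := L.existsUnique_fold G H
  have e1 : F ≫ fst _ _ = fst _ _ := by
    refine (L.existsUnique_fold (𝟙 A) (snd X A)).unique ⟨?_, ?_⟩ ⟨?_, ?_⟩
    · rw [reassoc_of% F0]; simp [G]
    · rw [reassoc_of% F1]; simp [H, pA]
    · simp
    · simp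
  have e2 : F ≫ snd _ _ ≫ fst _ _ = snd _ _ := by
    refine (L.existsUnique_fold (toUnit A ≫ L.nil) L.cons).unique ⟨?_, ?_⟩ ⟨?_, ?_⟩
    · rw [reassoc_of% F0]; simp [G]
    · rw [reassoc_of% F1]; simp [H, pL]
    · simp
    · simp only [whiskerLeft_snd]
      congr 1
      ext <;> simp
  refine ⟨F ≫ snd _ _ ≫ snd _ _, ⟨?_, ?_⟩, ?_⟩
  · rw [reassoc_of% F0]; simp [G]
  · rw [reassoc_of% F1]
    simp [H, pA, pL, pB, e1, e2]
  · rintro f ⟨f0, f1⟩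
    have : lift (fst _ _) (lift (snd _ _) f) = F := by
      refine Fu _ ⟨?_, ?_⟩
      · simp [G, f0]
      · simp only [comp_lift, f1, whiskerLeft_fst, whiskerLeft_snd, H, pA, pL, pB,
          lift_fst, lift_snd, ← Category.assoc]
        congr 2
        congr 1
        ext <;> simp
    rw [← this]
    simp

/-- The arrow `A × L(X) ⟶ B` defined by recursion on the list. -/
def ListObject.primRec {X : C} (L : ListObject X) {A B : C} (g : A ⟶ B)
    (h : A ⊗ (X ⊗ (L.obj ⊗ B)) ⟶ B) : A ⊗ L.obj ⟶ B :=
  (L.existsUnique_primRec g h).choose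

theorem ListObject.nil_primRec {X : C} (L : ListObject X) {A B : C} (g : A ⟶ B)
    (h : A ⊗ (X ⊗ (L.obj ⊗ B)) ⟶ B) :
    lift (𝟙 A) (toUnit A ≫ L.nil) ≫ L.primRec g h = g :=
  (L.existsUnique_primRec g h).choose_spec.1.1

theorem ListObject.cons_primRec {X : C} (L : ListObject X) {A B : C} (g : A ⟶ B)
    (h : A ⊗ (X ⊗ (L.obj ⊗ B)) ⟶ B) :
    (A ◁ L.cons) ≫ L.primRec g h =
      lift (fst A (X ⊗ L.obj)) (lift (snd A (X ⊗ L.obj) ≫ fst X L.obj)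
        (lift (snd A (X ⊗ L.obj) ≫ snd X L.obj) ((A ◁ snd X L.obj) ≫ L.primRec g h))) ≫ h :=
  (L.existsUnique_primRec g h).choose_spec.1.2

/-- Recursion without a parameter: `f nil = g` and `f (cons (x, l)) = h (x, l, f l)`. -/
def ListObject.primRec₀ {X : C} (L : ListObject X) {B : C} (g : 𝟙_ C ⟶ B)
    (h : X ⊗ (L.obj ⊗ B) ⟶ B) : L.obj ⟶ B :=
  lift (toUnit L.obj) (𝟙 L.obj) ≫ L.primRec g (snd (𝟙_ C) (X ⊗ (L.obj ⊗ B)) ≫ h)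

theorem ListObject.nil_primRec₀ {X : C} (L : ListObject X) {B : C} (g : 𝟙_ C ⟶ B)
    (h : X ⊗ (L.obj ⊗ B) ⟶ B) : L.nil ≫ L.primRec₀ g h = g := by
  have := L.nil_primRec g (snd (𝟙_ C) (X ⊗ (L.obj ⊗ B)) ≫ h)
  simpa [ListObject.primRec₀] using this

theorem ListObject.cons_primRec₀ {X : C} (L : ListObject X) {B : C} (g : 𝟙_ C ⟶ B)
    (h : X ⊗ (L.obj ⊗ B) ⟶ B) :
    L.cons ≫ L.primRec₀ g h =
      lift (fst X L.obj) (lift (snd X L.obj) (snd X L.obj ≫ L.primRec₀ g h)) ≫ h := by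
  have := lift (toUnit (X ⊗ L.obj)) (𝟙 (X ⊗ L.obj)) ≫=
    L.cons_primRec g (snd (𝟙_ C) (X ⊗ (L.obj ⊗ B)) ≫ h)
  simpa [ListObject.primRec₀, -id_whiskerLeft] using this

/-! ### The natural numbers object `N = L(1)` and its arithmetic -/

variable (L : ∀ X : C, ListObject X)

/-- The natural numbers object `N = L(1)`. -/
abbrev N : C := (L (𝟙_ C)).obj

def zero : 𝟙_ C ⟶ N L := (L (𝟙_ C)).nil

/-- The successor `n ↦ cons (*, n)`. -/
def succ : N L ⟶ N L := lift (toUnit (N L)) (𝟙 (N L)) ≫ (L (𝟙_ C)).cons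

/-- `N` is a parametrised natural numbers object: there is a unique `f` with
`f (a, 0) = g a` and `f (a, s n) = h (a, n, f (a, n))`. -/
theorem existsUnique_natRec {A B : C} (g : A ⟶ B) (h : A ⊗ (N L ⊗ B) ⟶ B) :
    ∃! f : A ⊗ N L ⟶ B,
      lift (𝟙 A) (toUnit A ≫ zero L) ≫ f = g ∧
      (A ◁ succ L) ≫ f = lift (fst A (N L)) (lift (snd A (N L)) f) ≫ h := by
  obtain ⟨f, ⟨f0, f1⟩, fu⟩ := (L (𝟙_ C)).existsUnique_primRec g
    ((A ◁ snd (𝟙_ C) (N L ⊗ B)) ≫ h)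
  have hk : ∀ k : A ⊗ N L ⟶ B,
      ((A ◁ succ L) ≫ k = lift (fst A (N L)) (lift (snd A (N L)) k) ≫ h) ↔
      (A ◁ (L (𝟙_ C)).cons) ≫ k =
        lift (fst A _) (lift (snd A _ ≫ fst (𝟙_ C) _)
          (lift (snd A _ ≫ snd (𝟙_ C) _) ((A ◁ snd (𝟙_ C) _) ≫ k))) ≫
            ((A ◁ snd (𝟙_ C) (N L ⊗ B)) ≫ h) := by
    intro k
    have i1 : (A ◁ snd (𝟙_ C) (N L)) ≫ (A ◁ lift (toUnit (N L)) (𝟙 (N L))) = 𝟙 _ := by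
      ext <;> simp
    have i2 : (A ◁ lift (toUnit (N L)) (𝟙 (N L))) ≫ (A ◁ snd (𝟙_ C) (N L)) = 𝟙 _ := by
      ext <;> simp
    constructor
    · intro e
      have := (A ◁ snd (𝟙_ C) (N L)) ≫= e
      rw [succ, MonoidalCategory.whiskerLeft_comp, Category.assoc, reassoc_of% i1] at this
      rw [this]
      simp only [← Category.assoc]
      congr 1
      ext <;> simp [N]
    · intro e
      rw [succ, MonoidalCategory.whiskerLeft_comp, Category.assoc, e]
      simp only [← Category.assoc]
      congr 1
      ext
      · simp
      · simp [N]
      · simp only [comp_lift, lift_whiskerLeft, lift_snd]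
        rw [reassoc_of% i2]
  exact ⟨f, ⟨f0, (hk f).2 f1⟩, fun k hk' => fu k ⟨hk'.1, (hk k).1 hk'.2⟩⟩

/-- The arrow `A × N ⟶ B` defined by recursion on the natural number. -/
def natRec {A B : C} (g : A ⟶ B) (h : A ⊗ (N L ⊗ B) ⟶ B) : A ⊗ N L ⟶ B :=
  (existsUnique_natRec L g h).choose

theorem zero_natRec {A B : C} (g : A ⟶ B) (h : A ⊗ (N L ⊗ B) ⟶ B) :
    lift (𝟙 A) (toUnit A ≫ zero L) ≫ natRec L g h = g :=
  (existsUnique_natRec L g h).choose_spec.1.1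

theorem succ_natRec {A B : C} (g : A ⟶ B) (h : A ⊗ (N L ⊗ B) ⟶ B) :
    (A ◁ succ L) ≫ natRec L g h =
      lift (fst A (N L)) (lift (snd A (N L)) (natRec L g h)) ≫ h :=
  (existsUnique_natRec L g h).choose_spec.1.2

/-- The predecessor: `P 0 = 0` and `P (s n) = n`. -/
def pred : N L ⟶ N L :=
  lift (toUnit (N L)) (𝟙 (N L)) ≫
    natRec L (A := 𝟙_ C) (zero L) (snd (𝟙_ C) (N L ⊗ N L) ≫ fst (N L) (N L))

theorem zero_pred : zero L ≫ pred L = zero L := by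
  have := zero_natRec L (A := 𝟙_ C) (zero L) (snd (𝟙_ C) (N L ⊗ N L) ≫ fst (N L) (N L))
  simpa [pred] using this

theorem succ_pred : succ L ≫ pred L = 𝟙 (N L) := by
  have := lift (toUnit (N L)) (𝟙 (N L)) ≫=
    succ_natRec L (A := 𝟙_ C) (zero L) (snd (𝟙_ C) (N L ⊗ N L) ≫ fst (N L) (N L))
  simpa [pred, -id_whiskerLeft] using this

/-- Truncated subtraction `(m, n) ↦ m ∸ n`: `m ∸ 0 = m` and `m ∸ s n = P (m ∸ n)`. -/
def sub : N L ⊗ N L ⟶ N L :=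
  natRec L (𝟙 (N L)) (snd (N L) (N L ⊗ N L) ≫ snd (N L) (N L) ≫ pred L)

theorem sub_zero : lift (𝟙 (N L)) (toUnit (N L) ≫ zero L) ≫ sub L = 𝟙 (N L) :=
  zero_natRec L _ _

theorem sub_succ : (N L ◁ succ L) ≫ sub L = sub L ≫ pred L := by
  have := succ_natRec L (𝟙 (N L)) (snd (N L) (N L ⊗ N L) ≫ snd (N L) (N L) ≫ pred L)
  simpa [sub] using this

/-- `Lt L m n` is the relation `m < n`, that is, `s m ∸ n = 0`, between generalised elements
`m, n : T ⟶ N`. -/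
def Lt {T : C} (m n : T ⟶ N L) : Prop :=
  lift (m ≫ succ L) n ≫ sub L = toUnit T ≫ zero L

/-! ### Arrows on lists -/

/-- The length: `len nil = 0` and `len (cons (x, l)) = s (len l)`. -/
def len (X : C) : (L X).obj ⟶ N L :=
  (L X).primRec₀ (zero L) (snd X ((L X).obj ⊗ N L) ≫ snd (L X).obj (N L) ≫ succ L)

theorem nil_len (X : C) : (L X).nil ≫ len L X = zero L :=
  (L X).nil_primRec₀ _ _

theorem cons_len (X : C) : (L X).cons ≫ len L X = snd X (L X).obj ≫ len L X ≫ succ L := by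
  have := (L X).cons_primRec₀ (zero L)
    (snd X ((L X).obj ⊗ N L) ≫ snd (L X).obj (N L) ≫ succ L)
  simpa [len] using this

/-- Truncation: `tr nil = nil` and `tr (cons (x, l)) = l`. -/
def tr (X : C) : (L X).obj ⟶ (L X).obj :=
  (L X).primRec₀ (L X).nil (snd X ((L X).obj ⊗ (L X).obj) ≫ fst (L X).obj (L X).obj)

theorem nil_tr (X : C) : (L X).nil ≫ tr L X = (L X).nil :=
  (L X).nil_primRec₀ _ _

theorem cons_tr (X : C) : (L X).cons ≫ tr L X = snd X (L X).obj := by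
  have := (L X).cons_primRec₀ (L X).nil
    (snd X ((L X).obj ⊗ (L X).obj) ≫ fst (L X).obj (L X).obj)
  simpa [tr] using this

/-- Iterated truncation: `tail (0, l) = l` and `tail (s n, l) = tr (tail (n, l))`. -/
def tail (X : C) : N L ⊗ (L X).obj ⟶ (L X).obj :=
  lift (snd (N L) (L X).obj) (fst (N L) (L X).obj) ≫
    natRec L (𝟙 (L X).obj)
      (snd (L X).obj (N L ⊗ (L X).obj) ≫ snd (N L) (L X).obj ≫ tr L X)

theorem zero_tail (X : C) :
    lift (toUnit (L X).obj ≫ zero L) (𝟙 (L X).obj) ≫ tail L X = 𝟙 (L X).obj := by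
  have := zero_natRec L (𝟙 (L X).obj)
      (snd (L X).obj (N L ⊗ (L X).obj) ≫ snd (N L) (L X).obj ≫ tr L X)
  simpa [tail] using this

theorem succ_tail (X : C) : (succ L ▷ (L X).obj) ≫ tail L X = tail L X ≫ tr L X := by
  have := lift (snd (N L) (L X).obj) (fst (N L) (L X).obj) ≫= succ_natRec L (𝟙 (L X).obj)
      (snd (L X).obj (N L ⊗ (L X).obj) ≫ snd (N L) (L X).obj ≫ tr L X)
  simpa [tail] using this

/-- The leading element of a list, or a default: `zerothDef (x, nil) = x` and
`zerothDef (x, cons (y, l)) = y`. -/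
def zerothDef (X : C) : X ⊗ (L X).obj ⟶ X :=
  (L X).primRec (𝟙 X) (snd X (X ⊗ ((L X).obj ⊗ X)) ≫ fst X ((L X).obj ⊗ X))

theorem zerothDef_nil (X : C) : lift (𝟙 X) (toUnit X ≫ (L X).nil) ≫ zerothDef L X = 𝟙 X :=
  (L X).nil_primRec _ _

theorem zerothDef_cons (X : C) :
    (X ◁ (L X).cons) ≫ zerothDef L X = snd X (X ⊗ (L X).obj) ≫ fst X (L X).obj := by
  have := (L X).cons_primRec (𝟙 X) (snd X (X ⊗ ((L X).obj ⊗ X)) ≫ fst X ((L X).obj ⊗ X))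
  simpa [zerothDef] using this

/-- `nthDef (x, n, l) = zerothDef (x, tail (n, l))`. -/
def nthDef (X : C) : X ⊗ (N L ⊗ (L X).obj) ⟶ X :=
  (X ◁ tail L X) ≫ zerothDef L X

/-! ### The two hypotheses -/

/-- For every `X`, both squares of the diagram with top row `1 ⟶ L(X) ⟵ X × L(X)`, bottom row
`1 ⟶ N ⟵ N` and vertical arrows `𝟙`, `len`, `len ∘ π₂` are pullbacks. -/
def H1 : Prop :=
  ∀ X : C, IsPullback (L X).nil (𝟙 (𝟙_ C)) (len L X) (zero L) ∧
    IsPullback (L X).cons (snd X (L X).obj ≫ len L X) (len L X) (succ L)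

/-- The cocone `0 : 1 ⟶ N ⟵ N : s` is a universal (pullback-stable) coproduct. -/
def H2 : Prop :=
  IsUniversalColimit (BinaryCofan.mk (zero L) (succ L))

/-! ### The object `E` of pairs `m < n`, and the arrow `nth` -/

/-- If `m < n` then `n = s (P n)`. -/
theorem eq_succ_pred_of_lt {T : C} {m n : T ⟶ N L} (h : Lt L m n) :
    n ≫ pred L ≫ succ L = n := by
  -- `r (n, k)` is `s (P n)` if `k = 0` and `n` otherwise
  let r : N L ⊗ N L ⟶ N L := natRec L (pred L ≫ succ L) (fst (N L) (N L ⊗ N L))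
  have r0 : lift (𝟙 _) (toUnit _ ≫ zero L) ≫ r = pred L ≫ succ L := zero_natRec L _ _
  have r1 : (N L ◁ succ L) ≫ r = fst _ _ := by
    simpa using succ_natRec L (pred L ≫ succ L) (fst (N L) (N L ⊗ N L))
  have r0' : ∀ {S : C} (a : S ⟶ N L),
      lift a (toUnit S ≫ zero L) ≫ r = a ≫ pred L ≫ succ L := by
    intro S a
    simpa using a ≫= r0
  have r1' : ∀ {S : C} (a b : S ⟶ N L), lift a (b ≫ succ L) ≫ r = a := by
    intro S a b
    simpa using lift a b ≫= r1
  have rs : (succ L ▷ N L) ≫ r = fst _ _ ≫ succ L := by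
    refine (existsUnique_natRec L (succ L) (fst _ _ ≫ succ L)).unique ⟨?_, ?_⟩ ⟨?_, ?_⟩
    · have := r0' (succ L)
      rw [reassoc_of% (succ_pred L)] at this
      simpa using this
    · have := r1' (fst (N L) (N L) ≫ succ L) (snd (N L) (N L))
      simp only [lift_fst_comp_snd_comp] at this
      rw [whisker_exchange_assoc, r1]
      simp
    · simp
    · simp
  have key : lift (snd (N L) (N L)) ((succ L ▷ N L) ≫ sub L) ≫ r = snd (N L) (N L) := by
    refine (existsUnique_natRec L (toUnit (N L) ≫ zero L)
      (snd _ _ ≫ fst _ _ ≫ succ L)).unique ⟨?_, ?_⟩ ⟨?_, ?_⟩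
    · have hs : lift (succ L) (toUnit (N L) ≫ zero L) ≫ sub L = succ L := by
        simpa using succ L ≫= sub_zero L
      have := r1' (toUnit (N L) ≫ zero L) (𝟙 _)
      simpa [hs] using this
    · have := lift (snd (N L) (N L)) ((N L ◁ succ L) ≫ (succ L ▷ N L) ≫ sub L) ≫= rs
      simpa using this
    · simp
    · simp
  have h2 := lift m n ≫= key
  simp only [comp_lift_assoc, lift_snd, lift_whiskerRight_assoc] at h2
  rw [h, r0'] at h2
  exact h2

variable [HasFiniteLimits C]

/-- `E = {(m, n) : N × N | m < n}`, the equaliser of `(m, n) ↦ s m ∸ n` and `(m, n) ↦ 0`. -/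
abbrev E : C := equalizer ((succ L ▷ N L) ≫ sub L) (toUnit (N L ⊗ N L) ≫ zero L)

def E.ι : E L ⟶ N L ⊗ N L :=
  equalizer.ι ((succ L ▷ N L) ≫ sub L) (toUnit (N L ⊗ N L) ≫ zero L)

/-- The first projection `(m, n) ↦ m`. -/
def E.π₁ : E L ⟶ N L := E.ι L ≫ fst (N L) (N L)

/-- The second projection `(m, n) ↦ n`. -/
def E.π₂ : E L ⟶ N L := E.ι L ≫ snd (N L) (N L)

theorem E.lt : Lt L (E.π₁ L) (E.π₂ L) := by
  have := equalizer.condition ((succ L ▷ N L) ≫ sub L) (toUnit (N L ⊗ N L) ≫ zero L)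
  have e : lift (E.π₁ L ≫ succ L) (E.π₂ L) = E.ι L ≫ (succ L ▷ N L) := by
    ext <;> simp [E.π₁, E.π₂]
  rw [Lt, e, Category.assoc, E.ι, this]
  simp [E]

/-- The pullback `E ×_N A` of `π₂ : E ⟶ N` along `l : A ⟶ N`. -/
abbrev EPullback {A : C} (l : A ⟶ N L) : C := pullback (E.π₂ L) l

/-- `Id_E ×_N f : E ×_N A ⟶ E ×_N B`, for `f : A ⟶ B` over `N`. -/
def idProd {A B : C} (lA : A ⟶ N L) (lB : B ⟶ N L) (f : A ⟶ B) (w : f ≫ lB = lA) :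
    EPullback L lA ⟶ EPullback L lB :=
  pullback.lift (pullback.fst (E.π₂ L) lA) (pullback.snd (E.π₂ L) lA ≫ f)
    (by rw [Category.assoc, w, pullback.condition])

/-- The term `m` of type `N` in the context `E ×_N L(X)`, whose elements are the pairs `(m, l)`
with `m < len l`. -/
def index (X : C) : EPullback L (len L X) ⟶ N L :=
  pullback.fst (E.π₂ L) (len L X) ≫ E.π₁ L

/-- The term `l` of type `L(X)` in the context `E ×_N L(X)`. -/
def list (X : C) : EPullback L (len L X) ⟶ (L X).obj :=
  pullback.snd (E.π₂ L) (len L X)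

theorem index_lt_len (X : C) : Lt L (index L X) (list L X ≫ len L X) := by
  have h := pullback.fst (E.π₂ L) (len L X) ≫= E.lt L
  rw [comp_lift_assoc, pullback.condition] at h
  simpa [Lt, index, list] using h

variable {L} in
/-- In the context `E ×_N L(X)` one has `len l > 0`, hence `len l = s (P (len l))`; as the right
square of the first hypothesis is a pullback, `l = cons (x, l')` for a unique pair `(x, l')`.
This arrow is that pair. -/
def uncons (h : H1 L) (X : C) : EPullback L (len L X) ⟶ X ⊗ (L X).obj :=
  (h X).2.lift (list L X) (list L X ≫ len L X ≫ pred L)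
    (by
      have := eq_succ_pred_of_lt L (index_lt_len L X)
      simpa using this.symm)

variable {L} in
theorem uncons_cons (h : H1 L) (X : C) : uncons h X ≫ (L X).cons = list L X :=
  (h X).2.lift_fst _ _ _

variable {L} in
/-- The default element: the term `x` of type `X` in the context `E ×_N L(X)`. -/
def defElt (h : H1 L) (X : C) : EPullback L (len L X) ⟶ X :=
  uncons h X ≫ fst X (L X).obj

variable {L} in
/-- `nth (m, l) = nthDef (def, m, l)` on `E ×_N L(X)`. -/
def nth (h : H1 L) (X : C) : EPullback L (len L X) ⟶ X :=
  lift (defElt h X) (lift (index L X) (list L X)) ≫ nthDef L X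

end

end ListPoly

namespace ListPoly

section

variable {C : Type u} [Category.{v} C] [CartesianMonoidalCategory C]

/-! ### Defining equations on generalised elements -/

section Elements

variable (L : ∀ X : C, ListObject X) {T : C}

/-! Two lists of equal length `l` with equal entries agree because they agree from the end forwards.
By induction on `k`, the tails of `h₁ a` and `h₂ a` at position `l a ∸ k` coincide. For `k = 0` both
have length `l a ∸ l a = 0`, so both are empty by (H1). For the step put `d = l a ∸ k`; the new
position is `P d`. If `d = 0`, nothing moves. If `d = s j`, then `j < l a`, and the hypothesis on
`nth` supplies the missing entry (`tail_eq_of_tail_succ_eq`). At `k = l a` the position is `0` and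
the tails are the lists themselves.

The internal logic is carried by two principles: induction for equations
(`hom_ext_of_nat_induction`), which needs only equalisers, and the case distinction `d = 0` or `d =
s j` (`H2.hom_ext`), which is where (H2) enters. -/

theorem lift_zero_sub (m : T ⟶ N L) : lift m (toUnit T ≫ zero L) ≫ sub L = m := by
  simpa [comp_lift_assoc] using m ≫= sub_zero L

theorem lift_succ_sub (m n : T ⟶ N L) :
    lift m (n ≫ succ L) ≫ sub L = lift m n ≫ sub L ≫ pred L := by
  simpa using lift m n ≫= sub_succ L

theorem lift_zero_tail {X : C} (l : T ⟶ (L X).obj) :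
    lift (toUnit T ≫ zero L) l ≫ tail L X = l := by
  simpa [comp_lift_assoc] using l ≫= zero_tail L X

theorem lift_succ_tail {X : C} (n : T ⟶ N L) (l : T ⟶ (L X).obj) :
    lift (n ≫ succ L) l ≫ tail L X = lift n l ≫ tail L X ≫ tr L X := by
  simpa using lift n l ≫= succ_tail L X

theorem lift_cons_zerothDef {X : C} (d : T ⟶ X) (p : T ⟶ X ⊗ (L X).obj) :
    lift d (p ≫ (L X).cons) ≫ zerothDef L X = p ≫ fst X (L X).obj := by
  simpa using lift d p ≫= zerothDef_cons L X

theorem len_tr (X : C) : tr L X ≫ len L X = len L X ≫ pred L := by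
  have h := ((L X).existsUnique_primRec (A := 𝟙_ C) (zero L)
    (snd _ _ ≫ snd _ _ ≫ fst _ _ ≫ len L X)).unique
    (y₁ := snd _ _ ≫ tr L X ≫ len L X) (y₂ := snd _ _ ≫ len L X ≫ pred L)
    ⟨by simp [reassoc_of% (nil_tr L X), nil_len],
      by simp [reassoc_of% (cons_tr L X), -id_whiskerLeft]⟩
    ⟨by simp [reassoc_of% (nil_len L X), zero_pred],
      by simp [reassoc_of% (cons_len L X), succ_pred, -id_whiskerLeft]⟩
  simpa using lift (toUnit _) (𝟙 _) ≫= h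

end Elements

/-! ### Induction and case distinction on natural numbers -/

variable (L : ∀ X : C, ListObject X)

/-- The equaliser of `f` and `g` contains zero and is closed under successor, so recursion defines
an arrow `F` into it. By uniqueness of recursion `F` is a section of the inclusion, which forces `f
= g`. -/
theorem hom_ext_of_nat_induction [HasFiniteLimits C] {A B : C} {f g : A ⊗ N L ⟶ B}
    (hzero : ∀ {T : C} (a : T ⟶ A),
      lift a (toUnit T ≫ zero L) ≫ f = lift a (toUnit T ≫ zero L) ≫ g)
    (hsucc : ∀ {T : C} (a : T ⟶ A) (n : T ⟶ N L), lift a n ≫ f = lift a n ≫ g →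
      lift a (n ≫ succ L) ≫ f = lift a (n ≫ succ L) ≫ g) : f = g := by
  let i := equalizer.ι f g
  let b : A ⟶ equalizer f g := equalizer.lift (lift (𝟙 A) (toUnit A ≫ zero L)) (hzero (𝟙 A))
  let σ : equalizer f g ⟶ equalizer f g := equalizer.lift (i ≫ (A ◁ succ L)) (by
    have e : lift (i ≫ fst _ _) (i ≫ snd _ _) = i := by ext <;> simp
    have := hsucc (i ≫ fst _ _) (i ≫ snd _ _) (by rw [e]; exact equalizer.condition f g)
    have e' : lift (i ≫ fst _ _) ((i ≫ snd _ _) ≫ succ L) = i ≫ (A ◁ succ L) := by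
      ext <;> simp
    rwa [e'] at this)
  obtain ⟨F, ⟨F0, F1⟩, -⟩ := existsUnique_natRec L b (snd _ _ ≫ snd _ _ ≫ σ)
  have hb : b ≫ i = lift (𝟙 A) (toUnit A ≫ zero L) := equalizer.lift_ι _ _
  have hσ : σ ≫ i = i ≫ (A ◁ succ L) := equalizer.lift_ι _ _
  have hF : F ≫ i = 𝟙 _ := by
    refine (existsUnique_natRec L (lift (𝟙 A) (toUnit A ≫ zero L))
      (snd _ _ ≫ snd _ _ ≫ (A ◁ succ L))).unique ⟨?_, ?_⟩ ⟨?_, ?_⟩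
    · rw [reassoc_of% F0, hb]
    · rw [reassoc_of% F1]
      simp [hσ]
    · simp
    · simp
  rw [← Category.id_comp f, ← Category.id_comp g, ← hF, Category.assoc, Category.assoc,
    equalizer.condition f g]

variable {L} in
-- Pulling the coproduct `1 + N` back along `d` presents `T` as the coproduct of the parts where `d`
-- is zero and where `d` is a successor; the two injections are jointly epic.
theorem H2.hom_ext [HasFiniteLimits C] (hL : H2 L) {T B : C} (d : T ⟶ N L) {f g : T ⟶ B}
    (hzero : ∀ {S : C} (t : S ⟶ T), t ≫ d = toUnit S ≫ zero L → t ≫ f = t ≫ g)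
    (hsucc : ∀ {S : C} (t : S ⟶ T) (n : S ⟶ N L), t ≫ d = n ≫ succ L → t ≫ f = t ≫ g) :
    f = g := by
  let c : BinaryCofan (pullback d (zero L)) (pullback d (succ L)) :=
    BinaryCofan.mk (pullback.fst d (zero L)) (pullback.fst d (succ L))
  obtain ⟨hc⟩ := hL c (mapPair (pullback.snd d (zero L)) (pullback.snd d (succ L))) d
    (by
      ext ⟨⟨⟩⟩
      · exact pullback.condition.symm
      · exact pullback.condition.symm)
    (NatTrans.Equifibered.of_discrete _)
    (by
      rintro ⟨⟨⟩⟩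
      · exact IsPullback.of_hasPullback d (zero L)
      · exact IsPullback.of_hasPullback d (succ L))
  refine BinaryCofan.IsColimit.hom_ext hc (hzero (pullback.fst d (zero L)) ?_)
    (hsucc (pullback.fst d (succ L)) (pullback.snd d (succ L)) pullback.condition)
  rw [pullback.condition]
  congr 1
  exact toUnit_unique _ _

/-! ### Truncated subtraction -/

section Arithmetic

variable [HasFiniteLimits C] {T : C}

/-- Subtraction recurses on its second argument; this moves a predecessor out of the first, which
the remaining identities need. -/
theorem lift_pred_sub (m n : T ⟶ N L) :
    lift (m ≫ pred L) n ≫ sub L = lift m n ≫ sub L ≫ pred L := by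
  have h : (pred L ▷ N L) ≫ sub L = sub L ≫ pred L := by
    refine hom_ext_of_nat_induction L (fun a => ?_) (fun a n ih => ?_)
    · simp [lift_zero_sub, reassoc_of% (lift_zero_sub L a)]
    · simp only [lift_whiskerRight_assoc] at ih ⊢
      rw [lift_succ_sub, reassoc_of% ih, reassoc_of% (lift_succ_sub L a n)]
  simpa using lift m n ≫= h

theorem succ_sub_succ (m n : T ⟶ N L) :
    lift (m ≫ succ L) (n ≫ succ L) ≫ sub L = lift m n ≫ sub L := by
  rw [lift_succ_sub, ← lift_pred_sub, Category.assoc, succ_pred, Category.comp_id]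

theorem sub_self (n : T ⟶ N L) : lift n n ≫ sub L = toUnit T ≫ zero L := by
  have h : snd (𝟙_ C) (N L) ≫ lift (𝟙 _) (𝟙 _) ≫ sub L = toUnit _ ≫ zero L := by
    refine hom_ext_of_nat_induction L (fun a => ?_) (fun a n ih => ?_)
    · simp [comp_lift_assoc, lift_zero_sub]
    · simpa [comp_lift_assoc, succ_sub_succ] using ih
  simpa [comp_lift_assoc] using lift (toUnit _) n ≫= h

/-- This says `m ∸ n ≤ m`. When `m ∸ n = s j` it reads `s j ∸ m = 0`, which is exactly `j < m`. -/
theorem sub_sub_self (m n : T ⟶ N L) :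
    lift (lift m n ≫ sub L) m ≫ sub L = toUnit T ≫ zero L := by
  have h : lift (sub L) (fst _ _) ≫ sub L = toUnit (N L ⊗ N L) ≫ zero L := by
    refine hom_ext_of_nat_induction L (fun a => ?_) (fun a n ih => ?_)
    · simp [comp_lift_assoc, lift_zero_sub, sub_self]
    · simp only [comp_lift_assoc, lift_fst, comp_toUnit_assoc] at ih ⊢
      rw [lift_succ_sub, ← Category.assoc, lift_pred_sub, reassoc_of% ih, zero_pred]
  simpa [comp_lift_assoc] using lift m n ≫= h

/-- Truncating a list lowers its length by one, stopping at zero. Hence tails at the same position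
of lists of equal length have equal length. -/
theorem len_tail {X : C} (n : T ⟶ N L) (l : T ⟶ (L X).obj) :
    lift n l ≫ tail L X ≫ len L X = lift (l ≫ len L X) n ≫ sub L := by
  have h : lift (snd _ _) (fst _ _) ≫ tail L X ≫ len L X = (len L X ▷ N L) ≫ sub L := by
    refine hom_ext_of_nat_induction L (fun a => ?_) (fun a n ih => ?_)
    · simp [comp_lift_assoc, lift_zero_sub, reassoc_of% (lift_zero_tail L a)]
    · simp only [comp_lift_assoc, lift_fst, lift_snd, lift_whiskerRight_assoc] at ih ⊢
      rw [reassoc_of% (lift_succ_tail L n a), len_tr, lift_succ_sub, reassoc_of% ih]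
  simpa [comp_lift_assoc] using lift l n ≫= h

end Arithmetic

/-! ### Lists of a given length -/

section Lists

variable {L} {T : C}

theorem H1.eq_nil (hL : H1 L) {X : C} {l : T ⟶ (L X).obj}
    (h : l ≫ len L X = toUnit T ≫ zero L) : l = toUnit T ≫ (L X).nil := by
  have e := (hL X).1.lift_fst l (toUnit T) h
  rw [← e]
  congr 1
  exact toUnit_unique _ _

theorem H1.exists_cons (hL : H1 L) {X : C} {l : T ⟶ (L X).obj} {n : T ⟶ N L}
    (h : l ≫ len L X = n ≫ succ L) : ∃ p : T ⟶ X ⊗ (L X).obj, l = p ≫ (L X).cons :=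
  ⟨_, ((hL X).2.lift_fst l n h).symm⟩

variable [HasFiniteLimits C]

/-- The element `(m, a)` of `E ×_N A`, for `m < l a`. -/
noncomputable def EPullback.mk {A : C} (l : A ⟶ N L) (m : T ⟶ N L) (a : T ⟶ A)
    (h : Lt L m (a ≫ l)) : T ⟶ EPullback L l :=
  pullback.lift
    (equalizer.lift (lift m (a ≫ l)) (by simpa [Lt] using h)) a
    (by simp [E.π₂, E.ι])

/-- The default element is left existential: it may differ for two lists, but `zerothDef` ignores it
on a nonempty list. -/
theorem EPullback.exists_mk_idProd_nth (hL : H1 L) {A X : C} (l : A ⟶ N L) (f : A ⟶ (L X).obj)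
    (w : f ≫ len L X = l) (m : T ⟶ N L) (a : T ⟶ A) (h : Lt L m (a ≫ l)) :
    ∃ d : T ⟶ X, EPullback.mk l m a h ≫ idProd L l (len L X) f w ≫ nth hL X =
      lift d (lift m (a ≫ f) ≫ tail L X) ≫ zerothDef L X := by
  refine ⟨EPullback.mk l m a h ≫ idProd L l (len L X) f w ≫ defElt hL X, ?_⟩
  have h1 : EPullback.mk l m a h ≫ idProd L l (len L X) f w ≫ index L X = m := by
    simp [EPullback.mk, idProd, index, E.π₁, E.ι, pullback.lift_fst_assoc]
  have h2 : EPullback.mk l m a h ≫ idProd L l (len L X) f w ≫ list L X = a ≫ f := by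
    simp [EPullback.mk, idProd, list, pullback.lift_snd_assoc, pullback.lift_snd]
  simp only [nth, nthDef, comp_lift_assoc, lift_whiskerLeft_assoc, h1, h2]

/-- If `l₁` and `l₂` have the same length, the same elements in position `j`, and agree after
position `j`, then they agree from position `j` on. -/
theorem tail_eq_of_tail_succ_eq (hH1 : H1 L) (hH2 : H2 L) {X : C} {l₁ l₂ : T ⟶ (L X).obj}
    (hlen : l₁ ≫ len L X = l₂ ≫ len L X) (j : T ⟶ N L)
    (hhead : ∃ d₁ d₂ : T ⟶ X, lift d₁ (lift j l₁ ≫ tail L X) ≫ zerothDef L X =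
      lift d₂ (lift j l₂ ≫ tail L X) ≫ zerothDef L X)
    (htail : lift (j ≫ succ L) l₁ ≫ tail L X = lift (j ≫ succ L) l₂ ≫ tail L X) :
    lift j l₁ ≫ tail L X = lift j l₂ ≫ tail L X := by
  obtain ⟨d₁, d₂, hhead⟩ := hhead
  have e₁ := len_tail L j l₁
  have e₂ := len_tail L j l₂
  rw [← hlen] at e₂
  rw [lift_succ_tail, lift_succ_tail, ← Category.assoc, ← Category.assoc] at htail
  rw [← Category.assoc] at e₁ e₂
  generalize lift j l₁ ≫ tail L X = t₁ at *
  generalize lift j l₂ ≫ tail L X = t₂ at *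
  -- Split on the common length of the two tails: both are empty, or both are a cons, whose heads
  -- are compared by `hhead` and whose remainders by `htail`.
  refine hH2.hom_ext (t₁ ≫ len L X) (fun t ht => ?_) (fun t n ht => ?_)
  · rw [hH1.eq_nil (l := t ≫ t₁) (by simpa using ht),
      hH1.eq_nil (l := t ≫ t₂) (by rw [Category.assoc, e₂, ← e₁, ht])]
  · obtain ⟨p, hp⟩ := hH1.exists_cons (l := t ≫ t₁) (n := n) (by simpa using ht)
    obtain ⟨q, hq⟩ := hH1.exists_cons (l := t ≫ t₂) (n := n)
      (by rw [Category.assoc, e₂, ← e₁, ht])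
    replace hhead := t ≫= hhead
    replace htail := t ≫= htail
    simp only [comp_lift_assoc, hp, hq, lift_cons_zerothDef] at hhead
    simp only [reassoc_of% hp, reassoc_of% hq, cons_tr] at htail
    rw [hp, hq, CartesianMonoidalCategory.hom_ext _ _ hhead htail]

end Lists

end

end ListPoly

theorem mainTheorem6 {C : Type u} [Category.{v} C] [CartesianMonoidalCategory C]
    [HasFiniteLimits C] (L : ∀ X : C, ListPoly.ListObject X)
    (hH1 : ListPoly.H1 L) (hH2 : ListPoly.H2 L) {A X : C} (h₁ h₂ : A ⟶ (L X).obj)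
    (hlen : h₁ ≫ ListPoly.len L X = h₂ ≫ ListPoly.len L X)
    (hnth :
      ListPoly.idProd L (h₁ ≫ ListPoly.len L X) (ListPoly.len L X) h₁ rfl ≫ ListPoly.nth hH1 X =
      ListPoly.idProd L (h₁ ≫ ListPoly.len L X) (ListPoly.len L X) h₂ hlen.symm ≫
        ListPoly.nth hH1 X) :
    h₁ = h₂ := by
  let l := h₁ ≫ ListPoly.len L X
  -- The position is `l a ∸ k`, so induction on `k` runs from the end of the lists to their
  -- beginning.
  have key : lift ((l ▷ ListPoly.N L) ≫ ListPoly.sub L) (fst _ _ ≫ h₁) ≫ ListPoly.tail L X =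
      lift ((l ▷ ListPoly.N L) ≫ ListPoly.sub L) (fst _ _ ≫ h₂) ≫ ListPoly.tail L X := by
    refine ListPoly.hom_ext_of_nat_induction L (fun a => ?_) (fun {T} a k ih => ?_)
    · have h (f : A ⟶ (L X).obj) (w : f ≫ ListPoly.len L X = l) :=
        hH1.eq_nil (l := lift (a ≫ l) (a ≫ f) ≫ ListPoly.tail L X)
          (by rw [Category.assoc, ListPoly.len_tail, Category.assoc, w, ListPoly.sub_self])
      simp only [comp_lift_assoc, lift_whiskerRight_assoc, lift_fst_assoc,
        ListPoly.lift_zero_sub]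
      rw [h h₁ rfl, h h₂ hlen.symm]
    · simp only [comp_lift_assoc, lift_whiskerRight_assoc, lift_fst_assoc,
        ListPoly.lift_succ_sub] at ih ⊢
      rw [← Category.assoc (lift _ _)]
      have hlt := ListPoly.sub_sub_self L (a ≫ l) k
      generalize lift (a ≫ l) k ≫ ListPoly.sub L = d at ih hlt ⊢
      refine hH2.hom_ext d (fun t ht => ?_) (fun t j ht => ?_)
      -- The start has already been reached: `P 0 = 0`, so the claim is the induction hypothesis.
      · replace ih := t ≫= ih
        simp only [comp_lift_assoc, reassoc_of% ht, ht, ListPoly.zero_pred] at ih ⊢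
        exact ih
      · replace ih := t ≫= ih
        simp only [comp_lift_assoc, reassoc_of% ht, ht, ListPoly.succ_pred,
          Category.comp_id] at ih ⊢
        have hj : ListPoly.Lt L j ((t ≫ a) ≫ l) := by
          have := t ≫= hlt
          simpa [comp_lift_assoc, ht, ListPoly.Lt] using this
        obtain ⟨d₁, hd₁⟩ := ListPoly.EPullback.exists_mk_idProd_nth hH1 l h₁ rfl j (t ≫ a) hj
        obtain ⟨d₂, hd₂⟩ :=
          ListPoly.EPullback.exists_mk_idProd_nth hH1 l h₂ hlen.symm j (t ≫ a) hj
        rw [← Category.assoc t, ← Category.assoc t] at ih ⊢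
        refine ListPoly.tail_eq_of_tail_succ_eq hH1 hH2 (by simp [hlen]) j ⟨d₁, d₂, ?_⟩ ih
        rw [← hd₁, ← hd₂]
        exact _ ≫= hnth
  -- Take `k = l a`, so that the position is `l a ∸ l a = 0`.
  have := lift (𝟙 A) l ≫= key
  simpa [comp_lift_assoc, ListPoly.sub_self, ListPoly.lift_zero_tail] using this
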